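/- Let $U\subset\mathbb R^m$ be compact, let $G,G_1\subseteq\mathbb R^n$ be open connected sets with $0\in G$ and $\bar G\subseteq G_1$, and let $f\colon G_1\times U\to\mathbb R^n$ be continuous. A control is a function $u(\cdot)\in\mathcal U=L^\infty_{\rm loc}([0,\infty),U)$; $x(\cdot\,;x_0,u(\cdot))$ denotes the (Carathéodory) solution in $G_1$ of $\dot x=f(x,u(t))$, $x(0)=x_0$. A function is of class $\mathcal K$ if it is a strictly increasing continuous function $[0,\infty)\to[0,\infty)$ vanishing at $0$, of class $\mathcal K_\infty$ if in addition it tends to $+\infty$ at $+\infty$, and of class $\mathcal L$ if it is a nonincreasing continuous function $[0,\infty)\to[0,\infty)$ tending to $0$ at $+\infty$; $\mathcal{KL}$ is the class of continuous $\beta\colon[0,\infty)^2\to[0,\infty)$ with $\beta(\cdot,t)\in\mathcal K$ and $\beta(\rho,\cdot)\in\mathcal L$ for all $\rho,t\ge 0$. $B_\rho(0)$ and $\bar B_\rho(0)$ are the open and closed Euclidean balls. Assume: (A) (i) for all $u(\cdot)\in\mathcal U$, $x_0\in G$ and $T\in(0,+\infty]$, every solution on $[0,T)$ starting at $x_0$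 stays in $G$; (ii) for every $R>0$ there is $C_{1,R}>0$ with $\|f(x,u)-f(x',u)\|\le C_{1,R}\|x-x'\|$ for $x,x'\in\bar B_R(0)\cap\bar G$, $u\in U$; (iii) there are a $C^1$ function $Y\colon G_1\to[0,\infty)$ such that the preimage of every compact set is compact, and $C_2>0$, with $\langle \mathrm DY(x),f(x,u)\rangle\le C_2Y(x)$ for all $x\in G_1$, $u\in U$. (B) $0\in U$ and $f(0,0)=0$, and there are $r>0$, $\bar u>0$, $\beta\in\mathcal{KL}$ and $\alpha_1,\alpha_2\in\mathcal K_\infty$ with $\bar B_r(0)\subset G$ and $\beta(\rho,t)\le\alpha_2(\alpha_1(\rho)e^{-t})$ for all $\rho,t\ge0$, and constants $C_{11},C_{12}>0$, such that one of the following holds: (B1) for every $x_0\in B_r(0)$ there is $u(\cdot)\in\mathcal U$ with $\|u\|_{L^\infty}\le\bar u$ and $\|x(t;x_0,u(\cdot))\|\le\beta(\|x_0\|,t)$ for all $t\ge0$; and $g(x,u)\le C_{11}(\alpha_2^{-1}(\|x\|))^{C_{12}}$ for $x\in\bar B_r(0)$, $u\in\bar B_{\bar u}(0)\cap U$; (B2)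 $\bar u=\beta(r,0)$, for every $x_0\in B_r(0)$ there is $u(\cdot)\in\mathcal U$ with $\|x(t;x_0,u(\cdot))\|+\|u(t)\|\le\beta(\|x_0\|,t)$ for all $t\ge0$; and $g(x,u)\le C_{11}(\alpha_2^{-1}(\|x\|+\|u\|))^{C_{12}}$ for $x\in\bar B_r(0)$, $u\in\bar B_{\bar u}(0)\cap U$. (C) $g\colon\bar G\times U\to[0,\infty)$ is continuous; for every $R>0$ there is $C_{5,R}>0$ with $|g(x,u)-g(x',u)|\le C_{5,R}\|x-x'\|$ for $x,x'\in\bar B_R(0)\cap\bar G$, $u\in U$; for every $R>0$, $\inf\{g(x,u):(x,u)\in\bar G\times U,\ \|x\|\ge R\}>0$ (where $\inf\emptyset=+\infty$); and there is $C_{13}>0$ with $g(x,u)\ge C_{13}\|f(x,u)\|$ for all $(x,u)\in\bar G\times U$ with $\|x\|\ge2r$ or $\|u\|\ge2\bar u$. (D) For every $x\in\bar G$ the set $\{(f(x,u),y)\in\mathbb R^n\times\mathbb R: u\in U,\ y\ge g(x,u)\}$ is convex. Let $\mathcal D_0$ be the set of $x_0\in G$ for which some $u(\cdot)\in\mathcal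 U$ satisfies $\lim_{t\to\infty}\|x(t;x_0,u(\cdot))\|=0$. Let $\delta\in(0,r]$ and $x_0\in\mathcal D_0\setminus\bar B_\delta(0)$, and put $T_\delta(x_0,u(\cdot))=\inf\{T\ge0: x(T;x_0,u(\cdot))\in\bar B_\delta(0)\}$ (with $\inf\emptyset=+\infty$). Then the two exit-time problems $$V_\delta(x_0)=\inf\Big\{\int_0^T g(x(t;x_0,u(\cdot)),u(t))\,dt:\ u(\cdot)\in\mathcal U,\ T\ge0,\ x(T;x_0,u(\cdot))\in\bar B_\delta(0)\Big\}$$ and $$\inf\Big\{\int_0^{T_\delta(x_0,u(\cdot))} g(x(t;x_0,u(\cdot)),u(t))\,dt:\ u(\cdot)\in\mathcal U,\ T_\delta(x_0,u(\cdot))<+\infty\Big\}$$ have the same finite value, and there exists a control $u^*(\cdot)\in\mathcal U$ that is optimal (attains the infimum) in both. -/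

import Mathlib

open MeasureTheory Set Filter Topology
open scoped NNReal ENNReal

noncomputable section

/-- Class `K`: strictly increasing continuous functions on `[0, ∞)` vanishing at `0`. -/
structure IsClassK (φ : ℝ≥0 → ℝ≥0) : Prop where
  strictMono : StrictMono φ
  continuous : Continuous φ
  map_zero : φ 0 = 0

/-- Class `K_∞`: functions of class `K` tending to `+∞` at `+∞`. -/
structure IsClassKInfty (φ : ℝ≥0 → ℝ≥0) : Prop extends IsClassK φ where
  tendsto_atTop : Tendsto φ atTop atTop

/-- Class `L`: nonincreasing continuous functions on `[0, ∞)` tending to `0` at `+∞`. -/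
structure IsClassL (φ : ℝ≥0 → ℝ≥0) : Prop where
  antitone : Antitone φ
  continuous : Continuous φ
  tendsto_zero : Tendsto φ atTop (𝓝 0)

/-- Class `KL`: jointly continuous, of class `K` in the first and of class `L` in the second
argument. -/
structure IsClassKL (β : ℝ≥0 → ℝ≥0 → ℝ≥0) : Prop where
  continuous : Continuous (Function.uncurry β)
  left : ∀ t, IsClassK (fun ρ => β ρ t)
  right : ∀ ρ, IsClassL (fun t => β ρ t)

variable {n m : ℕ}

/-- Control strategies: locally essentially bounded (Lebesgue measurable) functions
`[0, ∞) → U`; the values at negative times are irrelevant. -/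
structure IsControl (U : Set (EuclideanSpace ℝ (Fin m))) (u : ℝ → EuclideanSpace ℝ (Fin m)) :
    Prop where
  mem : ∀ t, 0 ≤ t → u t ∈ U
  locallyBounded : ∀ T : ℝ, MemLp u ∞ (volume.restrict (Icc 0 T))

/-- `x` is a Carathéodory solution, on the time interval `I` with left endpoint `0 ∈ I`, of
`x' = f (x, u)`, `x 0 = x₀`, with values in the domain `G₁` of `f (·, u)`.  Being absolutely
continuous with the equation satisfied almost everywhere is written in the integral form. -/
structure IsTrajectory (G₁ : Set (EuclideanSpace ℝ (Fin n)))
    (f : EuclideanSpace ℝ (Fin n) → EuclideanSpace ℝ (Fin m) → EuclideanSpace ℝ (Fin n))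
    (x₀ : EuclideanSpace ℝ (Fin n)) (u : ℝ → EuclideanSpace ℝ (Fin m)) (I : Set ℝ)
    (x : ℝ → EuclideanSpace ℝ (Fin n)) : Prop where
  mem : ∀ t ∈ I, x t ∈ G₁
  continuousOn : ContinuousOn x I
  integrable : ∀ t ∈ I, IntervalIntegrable (fun s => f (x s) (u s)) volume 0 t
  eq_integral : ∀ t ∈ I, x t = x₀ + ∫ s in (0 : ℝ)..t, f (x s) (u s)

/-- The standing assumptions on the control system. -/
structure SystemAssumption (U : Set (EuclideanSpace ℝ (Fin m)))
    (G G₁ : Set (EuclideanSpace ℝ (Fin n)))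
    (f : EuclideanSpace ℝ (Fin n) → EuclideanSpace ℝ (Fin m) → EuclideanSpace ℝ (Fin n)) :
    Prop where
  isCompact_U : IsCompact U
  isOpen_G : IsOpen G
  isConnected_G : IsConnected G
  isOpen_G₁ : IsOpen G₁
  isConnected_G₁ : IsConnected G₁
  closure_subset : closure G ⊆ G₁
  zero_mem : 0 ∈ G
  continuousOn_f : ContinuousOn (Function.uncurry f) (G₁ ×ˢ U)
  /-- Strong invariance of `G`: every trajectory on `[0, T)`, `0 < T ≤ +∞`, that starts in `G`
  stays in `G` (which is open, hence disjoint from its boundary). -/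
  invariant : ∀ x₀ ∈ G, ∀ u, IsControl U u → ∀ T : EReal, 0 < T → ∀ x,
    IsTrajectory G₁ f x₀ u {t : ℝ | 0 ≤ t ∧ (t : EReal) < T} x →
      ∀ t : ℝ, 0 ≤ t → (t : EReal) < T → x t ∈ G
  lipschitz : ∀ R : ℝ, 0 < R → ∃ C : ℝ, 0 < C ∧
    ∀ x ∈ Metric.closedBall 0 R ∩ closure G, ∀ x' ∈ Metric.closedBall 0 R ∩ closure G,
      ∀ u ∈ U, ‖f x u - f x' u‖ ≤ C * ‖x - x'‖
  /-- The preimages `G₁ ∩ Y ⁻¹' K` of compact sets `K` being compact says that the function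
  `Y : G₁ → [0, ∞)` is proper. -/
  growth : ∃ Y : EuclideanSpace ℝ (Fin n) → ℝ, ∃ C : ℝ, 0 < C ∧
    (∀ x ∈ G₁, 0 ≤ Y x) ∧ ContDiffOn ℝ 1 Y G₁ ∧
    (∀ K : Set ℝ, IsCompact K → IsCompact (G₁ ∩ Y ⁻¹' K)) ∧
    ∀ x ∈ G₁, ∀ u ∈ U, fderiv ℝ Y x (f x u) ≤ C * Y x

/-- The region of asymptotic null-controllability. -/
def nullControllableRegion (U : Set (EuclideanSpace ℝ (Fin m)))
    (G G₁ : Set (EuclideanSpace ℝ (Fin n)))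
    (f : EuclideanSpace ℝ (Fin n) → EuclideanSpace ℝ (Fin m) → EuclideanSpace ℝ (Fin n)) :
    Set (EuclideanSpace ℝ (Fin n)) :=
  {x₀ | x₀ ∈ G ∧ ∃ u, IsControl U u ∧ ∃ x, IsTrajectory G₁ f x₀ u (Ici 0) x ∧
    Tendsto (fun t => ‖x t‖) atTop (𝓝 0)}

/-- Local asymptotic null-controllability with controls bounded by `ubar`. -/
structure LocallyNullControllable (U : Set (EuclideanSpace ℝ (Fin m)))
    (G G₁ : Set (EuclideanSpace ℝ (Fin n)))
    (f : EuclideanSpace ℝ (Fin n) → EuclideanSpace ℝ (Fin m) → EuclideanSpace ℝ (Fin n))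
    (r ubar : ℝ≥0) (β : ℝ≥0 → ℝ≥0 → ℝ≥0) : Prop where
  zero_mem : 0 ∈ U
  equilibrium : f 0 0 = 0
  r_pos : 0 < r
  ubar_pos : 0 < ubar
  classKL : IsClassKL β
  closedBall_subset : Metric.closedBall 0 (r : ℝ) ⊆ G
  exists_control : ∀ x₀ ∈ Metric.ball (0 : EuclideanSpace ℝ (Fin n)) (r : ℝ),
    ∃ u, IsControl U u ∧ eLpNorm u ∞ (volume.restrict (Ici 0)) ≤ (ubar : ℝ≥0∞) ∧
      ∃ x, IsTrajectory G₁ f x₀ u (Ici 0) x ∧ ∀ t : ℝ≥0, ‖x t‖₊ ≤ β ‖x₀‖₊ t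

/-- The small control property. -/
structure SmallControlProperty (U : Set (EuclideanSpace ℝ (Fin m)))
    (G G₁ : Set (EuclideanSpace ℝ (Fin n)))
    (f : EuclideanSpace ℝ (Fin n) → EuclideanSpace ℝ (Fin m) → EuclideanSpace ℝ (Fin n))
    (r : ℝ≥0) (β : ℝ≥0 → ℝ≥0 → ℝ≥0) : Prop where
  zero_mem : 0 ∈ U
  equilibrium : f 0 0 = 0
  r_pos : 0 < r
  classKL : IsClassKL β
  closedBall_subset : Metric.closedBall 0 (r : ℝ) ⊆ G
  exists_control : ∀ x₀ ∈ Metric.ball (0 : EuclideanSpace ℝ (Fin n)) (r : ℝ),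
    ∃ u, IsControl U u ∧
      ∃ x, IsTrajectory G₁ f x₀ u (Ici 0) x ∧ ∀ t : ℝ≥0, ‖x t‖₊ + ‖u t‖₊ ≤ β ‖x₀‖₊ t

/-- Conditions on the running cost common to both controllability settings. -/
structure RunningCostAssumption (U : Set (EuclideanSpace ℝ (Fin m)))
    (G : Set (EuclideanSpace ℝ (Fin n)))
    (f : EuclideanSpace ℝ (Fin n) → EuclideanSpace ℝ (Fin m) → EuclideanSpace ℝ (Fin n))
    (g : EuclideanSpace ℝ (Fin n) → EuclideanSpace ℝ (Fin m) → ℝ) (r ubar : ℝ≥0) : Prop where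
  nonneg : ∀ x ∈ closure G, ∀ u ∈ U, 0 ≤ g x u
  continuousOn_g : ContinuousOn (Function.uncurry g) (closure G ×ˢ U)
  lipschitz : ∀ R : ℝ, 0 < R → ∃ C : ℝ, 0 < C ∧
    ∀ x ∈ Metric.closedBall 0 R ∩ closure G, ∀ x' ∈ Metric.closedBall 0 R ∩ closure G,
      ∀ u ∈ U, |g x u - g x' u| ≤ C * ‖x - x'‖
  /-- The infimum of `g` over `‖x‖ ≥ R` is positive (with `inf ∅ = +∞`). -/
  pos_away : ∀ R : ℝ, 0 < R → ∃ c : ℝ, 0 < c ∧ ∀ x ∈ closure G, ∀ u ∈ U, R ≤ ‖x‖ → c ≤ g x u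
  growth : ∃ C : ℝ, 0 < C ∧ ∀ x ∈ closure G, ∀ u ∈ U,
    (2 * (r : ℝ) ≤ ‖x‖ ∨ 2 * (ubar : ℝ) ≤ ‖u‖) → C * ‖f x u‖ ≤ g x u

/-- Upper bound of the running cost near the origin in terms of `α₂⁻¹ (‖x‖)`; a function `α₂` of
class `K_∞` is a bijection of `[0, ∞)`, so `Function.invFun α₂` is its inverse. -/
def CostBoundState (U : Set (EuclideanSpace ℝ (Fin m)))
    (g : EuclideanSpace ℝ (Fin n) → EuclideanSpace ℝ (Fin m) → ℝ) (r ubar : ℝ≥0)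
    (α₂ : ℝ≥0 → ℝ≥0) : Prop :=
  ∃ C p : ℝ, 0 < C ∧ 0 < p ∧ ∀ x ∈ Metric.closedBall 0 (r : ℝ),
    ∀ u ∈ Metric.closedBall 0 (ubar : ℝ) ∩ U,
      g x u ≤ C * ((Function.invFun α₂ ‖x‖₊ : ℝ≥0) : ℝ) ^ p

/-- Upper bound of the running cost near the origin in terms of `α₂⁻¹ (‖x‖ + ‖u‖)`. -/
def CostBoundStateControl (U : Set (EuclideanSpace ℝ (Fin m)))
    (g : EuclideanSpace ℝ (Fin n) → EuclideanSpace ℝ (Fin m) → ℝ) (r ubar : ℝ≥0)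
    (α₂ : ℝ≥0 → ℝ≥0) : Prop :=
  ∃ C p : ℝ, 0 < C ∧ 0 < p ∧ ∀ x ∈ Metric.closedBall 0 (r : ℝ),
    ∀ u ∈ Metric.closedBall 0 (ubar : ℝ) ∩ U,
      g x u ≤ C * ((Function.invFun α₂ (‖x‖₊ + ‖u‖₊) : ℝ≥0) : ℝ) ^ p

/-- The cost `∫₀ᵀ g (x t, u t) dt ∈ [0, +∞]` (for a nonnegative running cost). -/
def runningCost (g : EuclideanSpace ℝ (Fin n) → EuclideanSpace ℝ (Fin m) → ℝ)
    (x : ℝ → EuclideanSpace ℝ (Fin n)) (u : ℝ → EuclideanSpace ℝ (Fin m)) (T : ℝ) : ℝ≥0∞ :=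
  ∫⁻ t in Icc 0 T, ENNReal.ofReal (g (x t) (u t))

/-- The trajectory `x` of the control `u` from `x₀`, followed on `[0, T]`, ends in the closed ball
of radius `δ` about the origin. -/
def Reaches (G₁ : Set (EuclideanSpace ℝ (Fin n)))
    (f : EuclideanSpace ℝ (Fin n) → EuclideanSpace ℝ (Fin m) → EuclideanSpace ℝ (Fin n))
    (δ : ℝ) (x₀ : EuclideanSpace ℝ (Fin n)) (u : ℝ → EuclideanSpace ℝ (Fin m)) (T : ℝ≥0)
    (x : ℝ → EuclideanSpace ℝ (Fin n)) : Prop :=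
  IsTrajectory G₁ f x₀ u (Icc 0 (T : ℝ)) x ∧ x T ∈ Metric.closedBall 0 δ

/-- The value of the problem in which both the control and the terminal time are chosen, subject
to the trajectory being in the target ball at the terminal time (`+∞` if this is impossible). -/
def freeTimeValue (U : Set (EuclideanSpace ℝ (Fin m))) (G₁ : Set (EuclideanSpace ℝ (Fin n)))
    (f : EuclideanSpace ℝ (Fin n) → EuclideanSpace ℝ (Fin m) → EuclideanSpace ℝ (Fin n))
    (g : EuclideanSpace ℝ (Fin n) → EuclideanSpace ℝ (Fin m) → ℝ)
    (δ : ℝ) (x₀ : EuclideanSpace ℝ (Fin n)) : ℝ≥0∞ :=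
  sInf {J | ∃ u, IsControl U u ∧ ∃ T x, Reaches G₁ f δ x₀ u T x ∧ J = runningCost g x u T}

/-- The first time at which the control `u` brings `x₀` to the target ball (`+∞` if it never
does). -/
def exitTime (G₁ : Set (EuclideanSpace ℝ (Fin n)))
    (f : EuclideanSpace ℝ (Fin n) → EuclideanSpace ℝ (Fin m) → EuclideanSpace ℝ (Fin n))
    (δ : ℝ) (x₀ : EuclideanSpace ℝ (Fin n)) (u : ℝ → EuclideanSpace ℝ (Fin m)) : ℝ≥0∞ :=
  sInf {τ | ∃ T : ℝ≥0, ∃ x, Reaches G₁ f δ x₀ u T x ∧ τ = (T : ℝ≥0∞)}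

/-- The value of the problem in which only the control is chosen and the cost is accumulated up
to the exit time, which has to be finite. -/
def exitTimeValue (U : Set (EuclideanSpace ℝ (Fin m))) (G₁ : Set (EuclideanSpace ℝ (Fin n)))
    (f : EuclideanSpace ℝ (Fin n) → EuclideanSpace ℝ (Fin m) → EuclideanSpace ℝ (Fin n))
    (g : EuclideanSpace ℝ (Fin n) → EuclideanSpace ℝ (Fin m) → ℝ)
    (δ : ℝ) (x₀ : EuclideanSpace ℝ (Fin n)) : ℝ≥0∞ :=
  sInf {J | ∃ u, IsControl U u ∧ exitTime G₁ f δ x₀ u < ∞ ∧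
    ∃ x, IsTrajectory G₁ f x₀ u (Icc 0 (exitTime G₁ f δ x₀ u).toReal) x ∧
      J = runningCost g x u (exitTime G₁ f δ x₀ u).toReal}

/-- `u` is an optimal control in the problem with free terminal time. -/
def IsFreeTimeOptimal (U : Set (EuclideanSpace ℝ (Fin m))) (G₁ : Set (EuclideanSpace ℝ (Fin n)))
    (f : EuclideanSpace ℝ (Fin n) → EuclideanSpace ℝ (Fin m) → EuclideanSpace ℝ (Fin n))
    (g : EuclideanSpace ℝ (Fin n) → EuclideanSpace ℝ (Fin m) → ℝ)
    (δ : ℝ) (x₀ : EuclideanSpace ℝ (Fin n)) (u : ℝ → EuclideanSpace ℝ (Fin m)) : Prop :=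
  IsControl U u ∧ ∃ T x, Reaches G₁ f δ x₀ u T x ∧
    runningCost g x u T = freeTimeValue U G₁ f g δ x₀

/-- `u` is an optimal control in the problem with the cost accumulated up to the exit time. -/
def IsExitTimeOptimal (U : Set (EuclideanSpace ℝ (Fin m))) (G₁ : Set (EuclideanSpace ℝ (Fin n)))
    (f : EuclideanSpace ℝ (Fin n) → EuclideanSpace ℝ (Fin m) → EuclideanSpace ℝ (Fin n))
    (g : EuclideanSpace ℝ (Fin n) → EuclideanSpace ℝ (Fin m) → ℝ)
    (δ : ℝ) (x₀ : EuclideanSpace ℝ (Fin n)) (u : ℝ → EuclideanSpace ℝ (Fin m)) : Prop :=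
  IsControl U u ∧ exitTime G₁ f δ x₀ u < ∞ ∧
    ∃ x, IsTrajectory G₁ f x₀ u (Icc 0 (exitTime G₁ f δ x₀ u).toReal) x ∧
      runningCost g x u (exitTime G₁ f δ x₀ u).toReal = exitTimeValue U G₁ f g δ x₀

end

/-! This is the direct method. Take a minimizing sequence and cut each trajectory at its first entry
into the target ball. Up to then `g` is bounded below by a positive constant, so bounded costs bound
the times. Where `‖x‖ ≥ 2r`, `g` dominates a multiple of the speed, so bounded costs also bound the
excursions. All trajectories thus live in one compact set.

Adjoin the accumulated cost as an extra coordinate. The augmented curves are equi-Lipschitz and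
converge pointwise along a nonprincipal ultrafilter to a Lipschitz curve `Y`. Difference quotients
of the approximants are averages of velocities close to the augmented velocity set at `Y t`; that
set is closed and convex, so it contains `deriv Y t` for almost every `t`
(`HasDerivAt.mem_of_tendsto_integral`). Measurable selection then recovers a control generating the
state part of `Y` (`exists_control_of_deriv_mem_augmentedVelocitySet`). Since the set is an epigraph
in the cost direction, the actual cost is at most that of the limit.

The two problems agree because trajectories are unique: the first entry time is attained, and
cutting there cannot raise a nonnegative cost. Null-controllability makes the value finite. -/

/-! ### Analytic tools: Lipschitz curves, measurable selection, limits of derivatives. -/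

/-- The fundamental theorem of calculus for Lipschitz curves in a finite-dimensional space. -/
theorem LipschitzWith.intervalIntegrable_deriv {W : Type*} [NormedAddCommGroup W]
    [NormedSpace ℝ W] [FiniteDimensional ℝ W] {K : ℝ≥0} {X : ℝ → W} (hX : LipschitzWith K X)
    (a b : ℝ) : IntervalIntegrable (deriv X) volume a b := by
  have : CompleteSpace W := FiniteDimensional.complete ℝ W
  borelize W
  have := FiniteDimensional.proper ℝ W
  refine (intervalIntegrable_const (c := (K : ℝ))).mono_fun
    (measurable_deriv X).aestronglyMeasurable (ae_of_all _ fun t => ?_)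
  simpa using norm_deriv_le_of_lipschitz hX

theorem LipschitzWith.integral_deriv_eq_sub {W : Type*} [NormedAddCommGroup W]
    [NormedSpace ℝ W] [FiniteDimensional ℝ W] {K : ℝ≥0} {X : ℝ → W} (hX : LipschitzWith K X)
    (a b : ℝ) : ∫ t in a..b, deriv X t = X b - X a := by
  have : CompleteSpace W := FiniteDimensional.complete ℝ W
  -- Functionals separate points, which reduces the claim to the scalar theorem for absolutely
  -- continuous functions.
  refine (SeparatingDual.eq_iff_forall_dual_eq (R := ℝ)).2 fun φ => ?_
  rw [← ContinuousLinearMap.intervalIntegral_comp_comm φ (hX.intervalIntegrable_deriv a b),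
    map_sub, ← AbsolutelyContinuousOnInterval.integral_deriv_eq_sub (f := fun t => φ (X t))
      ((φ.lipschitz.comp hX).lipschitzOnWith.absolutelyContinuousOnInterval)]
  refine intervalIntegral.integral_congr_ae ?_
  filter_upwards [hX.ae_differentiableAt_real] with t ht _
  exact ((φ.hasFDerivAt.comp_hasDerivAt t ht.hasDerivAt).deriv).symm

/-- Measurable selection of a zero of a nonnegative Carathéodory function. -/
theorem exists_measurable_zero_selection {α Y : Type*} [MeasurableSpace α] [MetricSpace Y]
    [MeasurableSpace Y] [BorelSpace Y] {U : Set Y} (hU : IsCompact U) (hne : U.Nonempty)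
    {φ : α → Y → ℝ} (hmeas : ∀ y ∈ U, Measurable fun a => φ a y)
    (hcont : ∀ a, ContinuousOn (φ a) U) (hnonneg : ∀ a, ∀ y ∈ U, 0 ≤ φ a y)
    (hex : ∀ a, ∃ y ∈ U, φ a y = 0) :
    ∃ s : α → Y, Measurable s ∧ ∀ a, s a ∈ U ∧ φ a (s a) = 0 := by
  have : Nonempty U := hne.to_subtype
  have : CompactSpace U := isCompact_iff_compactSpace.1 hU
  obtain ⟨q, hq, hqs⟩ := exists_nat_bool_continuous_surjective_of_compact U
  -- The compact space `U` is a continuous image of the Cantor set, whose linear order singles out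
  -- one zero: the least one.
  set π : cantorSet → U := q ∘ cantorSetHomeomorphNatToBool with hπdef
  have hπ : Continuous π := hq.comp cantorSetHomeomorphNatToBool.continuous
  have hπs : Function.Surjective π := hqs.comp cantorSetHomeomorphNatToBool.surjective
  have : CompactSpace cantorSet := isCompact_iff_compactSpace.1 isCompact_cantorSet
  have hc : ∀ a, Continuous fun z => φ a (π z) := fun a =>
    (continuousOn_iff_continuous_domRestrict.1 (hcont a)).comp hπ
  have hmin : ∀ a, ∃ z : cantorSet, IsLeast {z | φ a (π z) = 0} z := fun a => by
    obtain ⟨y, hy, h0⟩ := hex a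
    obtain ⟨z, hz⟩ := hπs ⟨y, hy⟩
    exact ((isClosed_singleton.preimage (hc a)).isCompact (s := _)).exists_isLeast
      ⟨z, by simp [hz, h0]⟩
  choose ζ hζ using hmin
  have hζm : Measurable ζ := by
    suffices Measurable fun a => (ζ a : ℝ) from this.subtype_mk
    refine measurable_of_Iic fun c => ?_
    obtain ⟨D, hDc, hD⟩ := TopologicalSpace.exists_countable_dense {z : cantorSet | (z : ℝ) ≤ c}
    -- The least zero is at most `c` iff the minimum over the compact set `z ≤ c` is zero, iff
    -- values on a countable dense subset get arbitrarily small.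
    have : (fun a => (ζ a : ℝ)) ⁻¹' Iic c = ⋂ k : ℕ, ⋃ d ∈ D, {a | φ a (π d) < 1 / ((k : ℝ) + 1)} := by
      ext a
      simp only [mem_preimage, mem_iInter, mem_iUnion, mem_ofPred_eq, exists_prop]
      constructor
      · intro ha k
        have hopen : IsOpen {z : {z : cantorSet | (z : ℝ) ≤ c} | φ a (π z) < 1 / ((k : ℝ) + 1)} :=
          isOpen_lt ((hc a).comp continuous_subtype_val) continuous_const
        obtain ⟨d, hd, hdD⟩ := hD.inter_open_nonempty _ hopen
          ⟨⟨ζ a, ha⟩, by simp only [mem_ofPred_eq]; rw [(hζ a).1]; positivity⟩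
        exact ⟨d, hdD, hd⟩
      · intro h
        -- The case `k = 0` only shows that `z ≤ c` is a nonempty condition, so that a minimizer
        -- exists.
        obtain ⟨d₀, hd₀, -⟩ := h 0
        obtain ⟨z, hz, hzmin⟩ := (isClosed_le continuous_subtype_val continuous_const :
          IsClosed {z : cantorSet | (z : ℝ) ≤ c}).isCompact.exists_isMinOn
          ⟨d₀.1, d₀.2⟩ (hc a).continuousOn
        have hz0 : φ a (π z) ≤ 0 := by
          refine le_of_forall_pos_le_add fun ε hε => ?_
          obtain ⟨k, hk⟩ := exists_nat_one_div_lt hε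
          obtain ⟨d, -, hd⟩ := h k
          have := hzmin d.2
          simp only [mem_ofPred_eq] at this
          linarith
        exact (show (ζ a : ℝ) ≤ z from (hζ a).2 (le_antisymm hz0 (hnonneg a _ (π z).2))).trans hz
    rw [this]
    exact MeasurableSet.iInter fun k => MeasurableSet.biUnion hDc fun d _ =>
      measurableSet_lt (hmeas _ (π d).2) measurable_const
  exact ⟨fun a => π (ζ a), measurable_subtype_coe.comp (hπ.measurable.comp hζm),
    fun a => ⟨(π (ζ a)).2, (hζ a).1⟩⟩

/-- Derivatives of pointwise limits of integrals stay in the closed convex set which the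
integrands approach. -/
theorem HasDerivAt.mem_of_tendsto_integral {ι W : Type*} [NormedAddCommGroup W] [NormedSpace ℝ W]
    [CompleteSpace W] {F : Filter ι} [F.NeBot] {C : Set W} (hC : Convex ℝ C) (hcl : IsClosed C)
    {v X : ι → ℝ → W} {Y : ℝ → W} {t : ℝ} {p : W}
    (hv : ∀ k a b, IntervalIntegrable (v k) volume a b)
    (hX : ∀ k a b, X k b - X k a = ∫ s in a..b, v k s)
    (hlim : ∀ s, Tendsto (fun k => X k s) F (𝓝 (Y s))) (hder : HasDerivAt Y p t)
    (hnear : ∀ ε > 0, ∃ h₀ > 0, ∀ᶠ k in F, ∀ s ∈ Ioc t (t + h₀), v k s ∈ Metric.cthickening ε C) :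
    p ∈ C := by
  rw [← hcl.closure_eq, Metric.closure_eq_iInter_cthickening]
  refine mem_iInter₂.2 fun ε hε => ?_
  obtain ⟨h₀, hh₀, hev⟩ := hnear ε hε
  -- The quotients of `X k` are averages of `v k`, so they stay in the closed convex thickening. The
  -- limit in `k` comes first, then `h → 0+`.
  have hslope : ∀ h ∈ Ioc 0 h₀, h⁻¹ • (Y (t + h) - Y t) ∈ Metric.cthickening ε C := by
    intro h hh
    refine Metric.isClosed_cthickening.mem_of_tendsto
      (((hlim (t + h)).sub (hlim t)).const_smul h⁻¹) ?_
    filter_upwards [hev] with k hk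
    rw [hX]
    have := (hC.cthickening ε).set_average_mem (μ := volume) (t := Ioc t (t + h)) (f := v k)
      Metric.isClosed_cthickening (by simp [hh.1]) (by simp)
      ((ae_restrict_iff' measurableSet_Ioc).2 (ae_of_all _ fun s hs =>
        hk s ⟨hs.1, hs.2.trans (by linarith [hh.2])⟩))
      ((intervalIntegrable_iff_integrableOn_Ioc_of_le (by linarith [hh.1])).1 (hv k _ _))
    rw [setAverage_eq, ← intervalIntegral.integral_of_le (by linarith [hh.1])] at this
    simpa [Measure.real, hh.1.le] using this
  have hd := hder.tendsto_slope_zero_right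
  refine Metric.isClosed_cthickening.mem_of_tendsto hd ?_
  filter_upwards [Ioc_mem_nhdsGT hh₀] with h hh using hslope h hh

theorem ContinuousOn.aestronglyMeasurable_comp {α X Y : Type*} [MeasurableSpace α]
    {μ : Measure α} [TopologicalSpace X] [MeasurableSpace X] [OpensMeasurableSpace X]
    [NormedAddCommGroup Y] [SecondCountableTopology Y] {F : X → Y} {s : Set X}
    (hF : ContinuousOn F s) (hs : MeasurableSet s) {w : α → X} (hw : AEMeasurable w μ)
    (hws : ∀ᵐ a ∂μ, w a ∈ s) : AEStronglyMeasurable (fun a => F (w a)) μ := by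
  classical
  borelize Y
  have hm : Measurable (s.piecewise F fun _ => 0) := hF.measurable_piecewise continuousOn_const hs
  refine ((hm.comp_aemeasurable hw).aestronglyMeasurable).congr ?_
  filter_upwards [hws] with a ha
  simp [ha]

/-! ### Trajectories: invariance, uniqueness, first entry, bounds by the cost. -/

section Trajectory

variable {n m : ℕ} {U : Set (EuclideanSpace ℝ (Fin m))} {G G₁ : Set (EuclideanSpace ℝ (Fin n))}
  {f : EuclideanSpace ℝ (Fin n) → EuclideanSpace ℝ (Fin m) → EuclideanSpace ℝ (Fin n)}
  {g : EuclideanSpace ℝ (Fin n) → EuclideanSpace ℝ (Fin m) → ℝ}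
  {x₀ : EuclideanSpace ℝ (Fin n)} {u : ℝ → EuclideanSpace ℝ (Fin m)} {I J : Set ℝ}
  {x y : ℝ → EuclideanSpace ℝ (Fin n)} {T δ : ℝ} {r ubar : ℝ≥0}

theorem IsTrajectory.mono (h : IsTrajectory G₁ f x₀ u I x) (hJ : J ⊆ I) :
    IsTrajectory G₁ f x₀ u J x :=
  ⟨fun t ht => h.mem t (hJ ht), h.continuousOn.mono hJ, fun t ht => h.integrable t (hJ ht),
    fun t ht => h.eq_integral t (hJ ht)⟩

theorem IsTrajectory.apply_zero (h : IsTrajectory G₁ f x₀ u I x) (h0 : (0 : ℝ) ∈ I) :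
    x 0 = x₀ := by
  simpa using h.eq_integral 0 h0

theorem IsTrajectory.sub_eq_integral (h : IsTrajectory G₁ f x₀ u I x) {s t : ℝ} (hs : s ∈ I)
    (ht : t ∈ I) : x t - x s = ∫ τ in s..t, f (x τ) (u τ) := by
  rw [h.eq_integral t ht, h.eq_integral s hs, add_sub_add_left_eq_sub,
    intervalIntegral.integral_interval_sub_left (h.integrable t ht) (h.integrable s hs)]

/-- Invariance covers only the half-open interval; the endpoint follows by continuity, at the price
of the closure. -/
theorem IsTrajectory.mem_closure (hsys : SystemAssumption U G G₁ f) (hx₀ : x₀ ∈ G)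
    (hu : IsControl U u) (hx : IsTrajectory G₁ f x₀ u (Icc 0 T) x) {t : ℝ} (ht : t ∈ Icc 0 T) :
    x t ∈ closure G := by
  rcases ht.1.eq_or_lt with rfl | h0
  · rw [hx.apply_zero ht]; exact subset_closure hx₀
  have h0T : 0 < T := h0.trans_le ht.2
  have hI : {t : ℝ | 0 ≤ t ∧ (t : EReal) < (T : EReal)} = Ico 0 T := by
    ext t; simp
  have hG := hsys.invariant x₀ hx₀ u hu T (by exact_mod_cast h0T) x
    (hI ▸ hx.mono Ico_subset_Icc_self)
  have hmaps : MapsTo x (Ico 0 T) G := fun t ht => hG t ht.1 (by exact_mod_cast ht.2)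
  have hcl := hmaps.closure_of_continuousOn (by rw [closure_Ico h0T.ne]; exact hx.continuousOn)
  rw [closure_Ico h0T.ne] at hcl
  exact hcl ht

/-- Grönwall: both curves stay in a bounded part of `closure G`, where `f` is Lipschitz in the state
uniformly in the control. -/
theorem IsTrajectory.eqOn (hsys : SystemAssumption U G G₁ f) (hx₀ : x₀ ∈ G)
    (hu : IsControl U u) (hx : IsTrajectory G₁ f x₀ u (Icc 0 T) x)
    (hy : IsTrajectory G₁ f x₀ u (Icc 0 T) y) : EqOn x y (Icc 0 T) := by
  obtain ⟨R₁, hR₁⟩ := (isCompact_Icc.image_of_continuousOn hx.continuousOn).isBounded.exists_norm_le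
  obtain ⟨R₂, hR₂⟩ := (isCompact_Icc.image_of_continuousOn hy.continuousOn).isBounded.exists_norm_le
  obtain ⟨C, hC, hlip⟩ := hsys.lipschitz (max 1 (max R₁ R₂)) (by positivity)
  have hd : ∀ s ∈ Icc 0 T, ‖f (x s) (u s) - f (y s) (u s)‖ ≤ C * ‖x s - y s‖ := fun s hs =>
    hlip _ ⟨by simpa using Or.inr (Or.inl (hR₁ _ (mem_image_of_mem _ hs))),
      hx.mem_closure hsys hx₀ hu hs⟩ _
      ⟨by simpa using Or.inr (Or.inr (hR₂ _ (mem_image_of_mem _ hs))),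
      hy.mem_closure hsys hx₀ hu hs⟩ _ (hu.mem s hs.1)
  rcases lt_or_ge T 0 with hT | hT
  · simp [Icc_eq_empty hT.not_ge]
  have hcont : ContinuousOn (fun s => ‖x s - y s‖) (Icc 0 T) :=
    (hx.continuousOn.sub hy.continuousOn).norm
  have hint : ∀ t ∈ Icc 0 T, IntervalIntegrable (fun s => ‖x s - y s‖) volume 0 t := fun t ht =>
    (hcont.mono (Icc_subset_Icc_right ht.2)).intervalIntegrable_of_Icc ht.1
  have hle : ∀ t ∈ Icc 0 T, ‖x t - y t‖ ≤ C * ∫ s in (0 : ℝ)..t, ‖x s - y s‖ := by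
    intro t ht
    rw [hx.eq_integral t ht, hy.eq_integral t ht, add_sub_add_left_eq_sub,
      ← intervalIntegral.integral_sub (hx.integrable t ht) (hy.integrable t ht),
      ← intervalIntegral.integral_const_mul]
    refine intervalIntegral.norm_integral_le_of_norm_le ht.1 (ae_of_all _ fun s hs => ?_)
      ((hint t ht).const_mul C)
    exact hd s ⟨hs.1.le, hs.2.trans ht.2⟩
  -- Grönwall is applied to the primitive of `‖x - y‖`, which has a right derivative everywhere,
  -- whereas `‖x - y‖` itself need not.
  have hz := eq_zero_of_abs_deriv_le_mul_abs_self_of_eq_zero_right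
    (f := fun t => ∫ s in (0 : ℝ)..t, ‖x s - y s‖) (f' := fun t => ‖x t - y t‖) (K := C)
    (a := 0) (b := T)
    (by
      have := intervalIntegral.continuousOn_primitive_interval (μ := volume)
        (f := fun s => ‖x s - y s‖) (a := 0) (b := T)
      rw [uIcc_of_le hT] at this
      exact this hcont.integrableOn_Icc)
    (fun t ht => by
      have hle : 𝓝[>] t ≤ 𝓝[Icc 0 T] t := nhdsWithin_le_of_mem (Icc_mem_nhdsGT_of_mem ht)
      exact intervalIntegral.integral_hasDerivWithinAt_right (hint t ⟨ht.1, ht.2.le⟩)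
        ((hcont.stronglyMeasurableAtFilter_nhdsWithin measurableSet_Icc t).filter_mono hle)
        ((hcont t ⟨ht.1, ht.2.le⟩).mono_left hle))
    (by simp)
    (fun t ht => by
      rw [norm_norm, Real.norm_of_nonneg (intervalIntegral.integral_nonneg ht.1 fun _ _ => norm_nonneg _)]
      exact hle t ⟨ht.1, ht.2.le⟩)
  intro t ht
  have := hle t ht
  rw [hz t ht, mul_zero] at this
  exact sub_eq_zero.1 (norm_le_zero_iff.1 this)

/-- The times in `[0, T]` spent in the closed ball form a compact set, so a least one exists. Since
`exitTime` ranges over all trajectories of `u`, uniqueness is what excludes an earlier entry. -/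
theorem Reaches.exists_first {T : ℝ≥0} (hsys : SystemAssumption U G G₁ f) (hx₀ : x₀ ∈ G)
    (hu : IsControl U u) (h : Reaches G₁ f δ x₀ u T x) :
    ∃ τ ≤ T, Reaches G₁ f δ x₀ u τ x ∧ exitTime G₁ f δ x₀ u = τ ∧
      ∀ t ∈ Ico (0 : ℝ) τ, δ < ‖x t‖ := by
  obtain ⟨τ, ⟨hτ, hτδ⟩, hmin⟩ : ∃ τ, IsLeast (Icc (0 : ℝ) T ∩ x ⁻¹' Metric.closedBall 0 δ) τ :=
    (isCompact_Icc.of_isClosed_subset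
      (h.1.continuousOn.preimage_isClosed_of_isClosed isClosed_Icc Metric.isClosed_closedBall)
      inter_subset_left).exists_isLeast ⟨T, ⟨T.2, le_rfl⟩, h.2⟩
  lift τ to ℝ≥0 using hτ.1
  have hr : Reaches G₁ f δ x₀ u τ x := ⟨h.1.mono (Icc_subset_Icc_right hτ.2), hτδ⟩
  refine ⟨τ, by exact_mod_cast hτ.2, hr, le_antisymm (sInf_le ⟨τ, x, hr, rfl⟩) ?_, ?_⟩
  · refine le_sInf ?_
    rintro _ ⟨τ', y, hy, rfl⟩
    by_contra! hlt
    have hlt : τ' < τ := by exact_mod_cast hlt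
    have hleT : (τ' : ℝ) ≤ T := by exact_mod_cast hlt.le.trans hτ.2
    have heq : x (τ' : ℝ) = y (τ' : ℝ) := (h.1.mono (Icc_subset_Icc_right hleT)).eqOn hsys hx₀ hu hy.1 ⟨τ'.2, le_refl (τ' : ℝ)⟩
    have hmem : x (τ' : ℝ) ∈ Metric.closedBall 0 δ := by rw [heq]; exact hy.2
    have := hmin (a := (τ' : ℝ)) ⟨⟨τ'.2, hleT⟩, hmem⟩
    exact absurd hlt (not_lt.2 (by exact_mod_cast this))
  · intro t ht
    by_contra! hle
    have := hmin (a := t) ⟨⟨ht.1, ht.2.le.trans hτ.2⟩, by simpa using hle⟩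
    exact absurd ht.2 (not_lt.2 this)

theorem runningCost_congr (h : EqOn x y (Icc 0 T)) :
    runningCost g x u T = runningCost g y u T :=
  setLIntegral_congr_fun measurableSet_Icc fun t ht => by simp only [h ht]

theorem runningCost_mono {S : ℝ} (h : S ≤ T) : runningCost g x u S ≤ runningCost g x u T :=
  lintegral_mono_set (Icc_subset_Icc_right h)

/-- A running cost dominating the speed outside of a ball bounds the trajectory. -/
theorem IsTrajectory.norm_le (hx : IsTrajectory G₁ f x₀ u (Icc 0 T) x) {R C : ℝ} (hC : 0 < C)
    (hR : ‖x₀‖ ≤ R) (hg : ∀ t ∈ Icc 0 T, R ≤ ‖x t‖ → C * ‖f (x t) (u t)‖ ≤ g (x t) (u t))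
    (hfin : runningCost g x u T ≠ ∞) {t : ℝ} (ht : t ∈ Icc 0 T) :
    ‖x t‖ ≤ R + C⁻¹ * (runningCost g x u T).toReal := by
  rcases le_or_gt ‖x t‖ R with h | h
  · exact h.trans (le_add_of_nonneg_right (by positivity))
  -- `s` is the last time before `t` in the ball of radius `R`. On `(s, t]` the speed is at most
  -- `C⁻¹ * g`, so the displacement is at most `C⁻¹` times the cost.
  obtain ⟨s, ⟨hs, hsR⟩, hmax⟩ : ∃ s, IsGreatest (Icc (0 : ℝ) t ∩ x ⁻¹' Metric.closedBall 0 R) s :=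
    (isCompact_Icc.of_isClosed_subset
      ((hx.continuousOn.mono (Icc_subset_Icc_right ht.2)).preimage_isClosed_of_isClosed
        isClosed_Icc Metric.isClosed_closedBall) inter_subset_left).exists_isGreatest
      ⟨0, ⟨le_rfl, ht.1⟩, by simpa [hx.apply_zero ⟨le_rfl, ht.1.trans ht.2⟩] using hR⟩
  have hsub : x t - x s = ∫ τ in s..t, f (x τ) (u τ) :=
    hx.sub_eq_integral ⟨hs.1, hs.2.trans ht.2⟩ ht
  have hle : ‖x t - x s‖ₑ ≤ ENNReal.ofReal C⁻¹ * runningCost g x u T := by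
    rw [hsub, intervalIntegral.integral_of_le hs.2]
    refine (enorm_integral_le_lintegral_enorm _).trans ?_
    calc ∫⁻ τ in Ioc s t, ‖f (x τ) (u τ)‖ₑ
        ≤ ∫⁻ τ in Ioc s t, ENNReal.ofReal C⁻¹ * ENNReal.ofReal (g (x τ) (u τ)) := by
          refine setLIntegral_mono' measurableSet_Ioc fun τ hτ => ?_
          have hτ0 : 0 ≤ τ := hs.1.trans hτ.1.le
          have hτR : R ≤ ‖x τ‖ := by
            by_contra! hlt
            exact absurd hτ.1 (not_lt.2 (hmax ⟨⟨hτ0, hτ.2⟩, by simpa using hlt.le⟩))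
          rw [← ofReal_norm, ← ENNReal.ofReal_mul (by positivity)]
          refine ENNReal.ofReal_le_ofReal ?_
          rw [← div_eq_inv_mul, le_div_iff₀' hC]
          exact hg τ ⟨hτ0, hτ.2.trans ht.2⟩ hτR
      _ = ENNReal.ofReal C⁻¹ * ∫⁻ τ in Ioc s t, ENNReal.ofReal (g (x τ) (u τ)) :=
          lintegral_const_mul' _ _ ENNReal.ofReal_ne_top
      _ ≤ ENNReal.ofReal C⁻¹ * runningCost g x u T := by
          gcongr
          exact lintegral_mono_set fun τ hτ => ⟨hs.1.trans hτ.1.le, hτ.2.trans ht.2⟩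
  have hle' : ‖x t - x s‖ ≤ C⁻¹ * (runningCost g x u T).toReal := by
    have := ENNReal.toReal_mono (ENNReal.mul_ne_top ENNReal.ofReal_ne_top hfin) hle
    rwa [toReal_enorm, ENNReal.toReal_mul, ENNReal.toReal_ofReal (by positivity)] at this
  have hsR : ‖x s‖ ≤ R := by simpa using hsR
  calc ‖x t‖ = ‖x s + (x t - x s)‖ := by rw [add_sub_cancel]
    _ ≤ _ := (norm_add_le _ _).trans (add_le_add hsR hle')

theorem ofReal_mul_le_runningCost {c : ℝ} (hT : 0 ≤ T)
    (hc : ∀ t ∈ Ico 0 T, c ≤ g (x t) (u t)) :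
    ENNReal.ofReal (c * T) ≤ runningCost g x u T := by
  calc ENNReal.ofReal (c * T) = ∫⁻ _ in Ico 0 T, ENNReal.ofReal c := by
        simp [ENNReal.ofReal_mul' hT]
    _ ≤ ∫⁻ t in Ico 0 T, ENNReal.ofReal (g (x t) (u t)) :=
        setLIntegral_mono' measurableSet_Ico fun t ht => ENNReal.ofReal_le_ofReal (hc t ht)
    _ ≤ _ := lintegral_mono_set Ico_subset_Icc_self

theorem runningCost_lt_top (hsys : SystemAssumption U G G₁ f)
    (hcost : RunningCostAssumption U G f g r ubar) (hx₀ : x₀ ∈ G) (hu : IsControl U u)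
    (hx : IsTrajectory G₁ f x₀ u (Icc 0 T) x) : runningCost g x u T < ∞ := by
  obtain ⟨B, hB⟩ := (((isCompact_Icc.image_of_continuousOn hx.continuousOn).prod
    hsys.isCompact_U).image_of_continuousOn (hcost.continuousOn_g.mono (prod_mono (by
      rintro _ ⟨t, ht, rfl⟩; exact hx.mem_closure hsys hx₀ hu ht) le_rfl))).isBounded.exists_norm_le
  calc runningCost g x u T ≤ ∫⁻ _ in Icc 0 T, ENNReal.ofReal B :=
        setLIntegral_mono' measurableSet_Icc fun t ht => ENNReal.ofReal_le_ofReal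
          ((le_abs_self _).trans (hB _ ⟨(x t, u t), ⟨⟨t, ht, rfl⟩, hu.mem t ht.1⟩, rfl⟩))
    _ < ∞ := by simp [ENNReal.mul_lt_top]

end Trajectory

/-! ### Compactness along a nonprincipal ultrafilter. -/

/-- A fixed ultrafilter makes all bounded sequences converge at once, so no diagonal extraction of
subsequences is needed. -/
theorem exists_tendsto_hyperfilter {W : Type*} [PseudoMetricSpace W] [ProperSpace W] {w : ℕ → W}
    {c : W} {R : ℝ} (h : ∀ k, w k ∈ Metric.closedBall c R) :
    ∃ y, Tendsto w (hyperfilter ℕ) (𝓝 y) := by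
  obtain ⟨y, -, hy⟩ := (isCompact_closedBall c R).ultrafilter_le_nhds ((hyperfilter ℕ).map w)
    (le_principal_iff.2 (Eventually.of_forall (f := (hyperfilter ℕ : Filter ℕ)) h))
  exact ⟨y, hy⟩

theorem lipschitzWith_integral {W : Type*} [NormedAddCommGroup W] [NormedSpace ℝ W]
    {v : ℝ → W} {B : ℝ≥0} (hint : ∀ a b, IntervalIntegrable v volume a b)
    (hB : ∀ s, ‖v s‖ ≤ B) (w₀ : W) : LipschitzWith B fun t => w₀ + ∫ s in (0 : ℝ)..t, v s := by
  refine LipschitzWith.of_dist_le_mul fun t s => ?_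
  rw [dist_add_left, dist_eq_norm, intervalIntegral.integral_interval_sub_left (hint _ _)
    (hint _ _), Real.dist_eq]
  exact intervalIntegral.norm_integral_le_of_norm_le_const fun τ _ => hB τ

theorem exists_lipschitzWith_tendsto_integral {W : Type*} [NormedAddCommGroup W]
    [NormedSpace ℝ W] [ProperSpace W] {v : ℕ → ℝ → W} {B : ℝ≥0}
    (hint : ∀ k a b, IntervalIntegrable (v k) volume a b) (hB : ∀ k s, ‖v k s‖ ≤ B) (w₀ : W) :
    ∃ Y : ℝ → W, LipschitzWith B Y ∧
      ∀ t, Tendsto (fun k => w₀ + ∫ s in (0 : ℝ)..t, v k s) (hyperfilter ℕ) (𝓝 (Y t)) := by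
  have hlip := fun k => lipschitzWith_integral (hint k) (hB k) w₀
  have hex : ∀ t : ℝ, ∃ y,
      Tendsto (fun k => w₀ + ∫ s in (0 : ℝ)..t, v k s) (hyperfilter ℕ) (𝓝 y) := fun t =>
    exists_tendsto_hyperfilter (c := w₀) (R := B * dist t 0) fun k => by
      simpa using (hlip k).dist_le_mul t 0
  choose Y hY using hex
  exact ⟨Y, LipschitzWith.of_dist_le_mul fun t s => le_of_tendsto ((hY t).dist (hY s))
    (Eventually.of_forall fun k => (hlip k).dist_le_mul t s), hY⟩

/-! ### Augmented velocity sets and recovery of a control. -/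

section Filippov

variable {n m : ℕ} {U : Set (EuclideanSpace ℝ (Fin m))} {G G₁ A : Set (EuclideanSpace ℝ (Fin n))}
  {f : EuclideanSpace ℝ (Fin n) → EuclideanSpace ℝ (Fin m) → EuclideanSpace ℝ (Fin n)}
  {g : EuclideanSpace ℝ (Fin n) → EuclideanSpace ℝ (Fin m) → ℝ}
  {x₀ : EuclideanSpace ℝ (Fin n)} {T δ : ℝ}

/-- The velocity set augmented by the epigraph of the running cost. -/
def augmentedVelocitySet (U : Set (EuclideanSpace ℝ (Fin m)))
    (f : EuclideanSpace ℝ (Fin n) → EuclideanSpace ℝ (Fin m) → EuclideanSpace ℝ (Fin n))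
    (g : EuclideanSpace ℝ (Fin n) → EuclideanSpace ℝ (Fin m) → ℝ)
    (x : EuclideanSpace ℝ (Fin n)) : Set (EuclideanSpace ℝ (Fin n) × ℝ) :=
  {q | ∃ u ∈ U, q.1 = f x u ∧ g x u ≤ q.2}

/-- Compactness of `U`: controls realizing a convergent sequence of points subconverge to one
realizing the limit. -/
theorem isClosed_augmentedVelocitySet (hU : IsCompact U) {x : EuclideanSpace ℝ (Fin n)}
    (hf : ContinuousOn (f x) U) (hg : ContinuousOn (g x) U) :
    IsClosed (augmentedVelocitySet U f g x) := by
  refine isClosed_of_closure_subset fun q hq => ?_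
  obtain ⟨p, hp, hlim⟩ := mem_closure_iff_seq_limit.1 hq
  choose w hwU hw1 hw2 using hp
  obtain ⟨w₀, hw₀, ψ, hψ, hψlim⟩ := hU.tendsto_subseq hwU
  have hwithin : Tendsto (w ∘ ψ) atTop (𝓝[U] w₀) :=
    tendsto_nhdsWithin_iff.2 ⟨hψlim, Eventually.of_forall fun k => hwU _⟩
  have hlim' := hlim.comp hψ.tendsto_atTop
  refine ⟨w₀, hw₀, ?_, ?_⟩
  · refine tendsto_nhds_unique ((continuous_fst.tendsto q).comp hlim') ?_
    exact ((hf w₀ hw₀).tendsto.comp hwithin).congr fun k => (hw1 _).symm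
  · exact le_of_tendsto_of_tendsto' ((hg w₀ hw₀).tendsto.comp hwithin)
      ((continuous_snd.tendsto q).comp hlim') fun k => hw2 _

/-- Filippov's lemma: a curve whose derivative lies in the augmented velocity sets is generated
by a control. -/
theorem exists_control_of_deriv_mem_augmentedVelocitySet (hU : IsCompact U) (hne : U.Nonempty)
    (hA : IsClosed A) (hAG : A ⊆ G₁) {B : ℝ}
    (hf : ContinuousOn (Function.uncurry f) (A ×ˢ U))
    (hg : ContinuousOn (Function.uncurry g) (A ×ˢ U))
    (hfB : ∀ x ∈ A, ∀ u ∈ U, ‖f x u‖ ≤ B) (hg0 : ∀ x ∈ A, ∀ u ∈ U, 0 ≤ g x u)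
    {Y : ℝ → EuclideanSpace ℝ (Fin n) × ℝ} {K : ℝ≥0} (hY : LipschitzWith K Y)
    (hY0 : Y 0 = (x₀, 0)) (hT : 0 ≤ T) (hYA : ∀ t ∈ Icc 0 T, (Y t).1 ∈ A)
    (hder : ∀ᵐ t, t ∈ Ioo 0 T → deriv Y t ∈ augmentedVelocitySet U f g (Y t).1) :
    ∃ u, IsControl U u ∧ ∃ x, IsTrajectory G₁ f x₀ u (Icc 0 T) x ∧ x T = (Y T).1 ∧
      runningCost g x u T ≤ ENNReal.ofReal (Y T).2 := by
  -- Freezing the state outside `[0, T]` keeps it in `A` at all times, so measurability can be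
  -- handled on the whole line.
  set ξ : ℝ → EuclideanSpace ℝ (Fin n) := fun t => (Y (projIcc 0 T hT t)).1 with hξdef
  have hξ : Continuous ξ :=
    continuous_fst.comp (hY.continuous.comp (continuous_subtype_val.comp continuous_projIcc))
  have hξA : ∀ t, ξ t ∈ A := fun t => hYA _ (projIcc 0 T hT t).2
  have hξY : ∀ t ∈ Icc 0 T, ξ t = (Y t).1 := fun t ht => by
    simp only [hξdef, projIcc_of_mem hT ht]
  obtain ⟨N, hNsub, hNm, hN0⟩ := exists_measurable_superset_of_null hder
  -- A measurable set of full measure in `[0, T]` on which the inclusion holds everywhere.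
  set D : Set ℝ := Ioo 0 T ∩ Nᶜ with hDdef
  have hDm : MeasurableSet D := measurableSet_Ioo.inter hNm.compl
  have hD : ∀ t ∈ D, deriv Y t ∈ augmentedVelocitySet U f g (ξ t) := fun t ht => by
    rw [hξY t (Ioo_subset_Icc_self ht.1)]
    by_contra hcon
    exact ht.2 (hNsub fun h => hcon (h ht.1))
  have hDae : ∀ᵐ t, t ∈ Icc 0 T → t ∈ D := by
    filter_upwards [compl_mem_ae_iff.2 hN0, Ioo_ae_eq_Icc (μ := volume) (a := (0 : ℝ)) (b := T)]
      with t ht htI hI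
    exact ⟨htI.mpr hI, ht⟩
  have hYm : Measurable (deriv Y) := measurable_deriv Y
  -- On `D`, a zero is exactly a control with the right velocity and no excess cost; off `D` every
  -- control value is a zero.
  obtain ⟨u, hum, hu⟩ := exists_measurable_zero_selection hU hne
    (φ := fun t y => D.indicator (fun t => ‖f (ξ t) y - (deriv Y t).1‖ +
      max (g (ξ t) y - (deriv Y t).2) 0) t)
    (fun y hy => by
      have h1 : Continuous fun t => f (ξ t) y := hf.comp_continuous (by fun_prop)
        (f := fun t => (ξ t, y)) fun t => ⟨hξA t, hy⟩
      have h2 : Continuous fun t => g (ξ t) y := hg.comp_continuous (by fun_prop)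
        (f := fun t => (ξ t, y)) fun t => ⟨hξA t, hy⟩
      exact (((h1.measurable.sub hYm.fst).norm).add
        ((h2.measurable.sub hYm.snd).max measurable_const)).indicator hDm)
    (fun t => by
      by_cases ht : t ∈ D
      · simp only [indicator_of_mem ht]
        have h1 : ContinuousOn (f (ξ t)) U := hf.comp (f := fun y => (ξ t, y)) (by fun_prop)
          fun y hy => ⟨hξA t, hy⟩
        have h2 : ContinuousOn (g (ξ t)) U := hg.comp (f := fun y => (ξ t, y)) (by fun_prop)
          fun y hy => ⟨hξA t, hy⟩
        exact (h1.sub continuousOn_const).norm.add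
          ((h2.sub continuousOn_const).sup continuousOn_const)
      · simp only [indicator_of_notMem ht]
        exact continuousOn_const)
    (fun t y _ => indicator_nonneg (fun t _ => by positivity) t)
    (fun t => by
      by_cases ht : t ∈ D
      · obtain ⟨y, hy, h1, h2⟩ := hD t ht
        exact ⟨y, hy, by simp [indicator_of_mem ht, h1, h2]⟩
      · exact ⟨hne.some, hne.some_mem, indicator_of_notMem ht _⟩)
  have huD : ∀ t ∈ D, f (ξ t) (u t) = (deriv Y t).1 ∧ g (ξ t) (u t) ≤ (deriv Y t).2 := by
    intro t ht
    have h := (hu t).2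
    rw [indicator_of_mem ht, add_eq_zero_iff_of_nonneg (norm_nonneg _) (le_max_right _ _),
      norm_eq_zero, sub_eq_zero, max_eq_right_iff, sub_nonpos] at h
    exact h
  obtain ⟨M, hM⟩ := hU.isBounded.exists_norm_le
  have hmeas : AEStronglyMeasurable (fun t => f (ξ t) (u t)) volume :=
    hf.aestronglyMeasurable_comp (w := fun t => (ξ t, u t))
      (hA.measurableSet.prod hU.measurableSet)
      (hξ.measurable.prodMk hum).aemeasurable (ae_of_all _ fun t => ⟨hξA t, (hu t).1⟩)
  have hYi := hY.intervalIntegrable_deriv 0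
  refine ⟨u, ⟨fun t _ => (hu t).1, fun S => memLp_top_of_bound hum.aestronglyMeasurable M
    (ae_of_all _ fun t => hM _ (hu t).1)⟩, ξ, ⟨fun t _ => hAG (hξA t), hξ.continuousOn,
    fun t _ => (intervalIntegrable_const (c := B)).mono_fun hmeas.restrict (ae_of_all _ fun s =>
      (hfB _ (hξA s) _ (hu s).1).trans (le_abs_self B)), fun t ht => ?_⟩,
    hξY T ⟨hT, le_rfl⟩, ?_⟩
  · have hcongr : ∫ s in (0 : ℝ)..t, f (ξ s) (u s) = ∫ s in (0 : ℝ)..t, (deriv Y s).1 := by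
      refine intervalIntegral.integral_congr_ae ?_
      filter_upwards [hDae] with s hs hsI
      rw [uIoc_of_le ht.1] at hsI
      exact (huD s (hs ⟨hsI.1.le, hsI.2.trans ht.2⟩)).1
    have hfst := (ContinuousLinearMap.fst ℝ (EuclideanSpace ℝ (Fin n)) ℝ).intervalIntegral_comp_comm
      (hYi t)
    simp only [ContinuousLinearMap.coe_fst'] at hfst
    rw [hcongr, hfst, hY.integral_deriv_eq_sub, hξY t ht, hY0]
    simp
  · have hsnd := (ContinuousLinearMap.snd ℝ (EuclideanSpace ℝ (Fin n)) ℝ).intervalIntegral_comp_comm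
      (hYi T)
    simp only [ContinuousLinearMap.coe_snd'] at hsnd
    rw [hY.integral_deriv_eq_sub, hY0] at hsnd
    have hsndi : IntegrableOn (fun s => (deriv Y s).2) (Icc 0 T) := by
      rw [integrableOn_Icc_iff_integrableOn_Ioc]
      exact ((intervalIntegrable_iff_integrableOn_Ioc_of_le hT).1 (hYi T)).snd
    have hle : ∀ᵐ t ∂volume.restrict (Icc 0 T), g (ξ t) (u t) ≤ (deriv Y t).2 :=
      (ae_restrict_iff' measurableSet_Icc).2 (hDae.mono fun t ht hI => (huD t (ht hI)).2)
    calc runningCost g ξ u T ≤ ∫⁻ t in Icc 0 T, ENNReal.ofReal (deriv Y t).2 :=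
          lintegral_mono_ae (hle.mono fun t ht => ENNReal.ofReal_le_ofReal ht)
      _ = ENNReal.ofReal (∫ t in Icc 0 T, (deriv Y t).2) :=
          (ofReal_integral_eq_lintegral_ofReal hsndi (hle.mono fun t ht =>
            (hg0 _ (hξA t) _ (hu t).1).trans ht)).symm
      _ = ENNReal.ofReal (Y T).2 := by
          rw [integral_Icc_eq_integral_Ioc, ← intervalIntegral.integral_of_le hT, hsnd]
          simp

end Filippov

/-! ### Passage to the limit in sequences of trajectories. -/

section Existence

variable {n m : ℕ} {U : Set (EuclideanSpace ℝ (Fin m))} {G G₁ A : Set (EuclideanSpace ℝ (Fin n))}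
  {f : EuclideanSpace ℝ (Fin n) → EuclideanSpace ℝ (Fin m) → EuclideanSpace ℝ (Fin n)}
  {g : EuclideanSpace ℝ (Fin n) → EuclideanSpace ℝ (Fin m) → ℝ}
  {x₀ : EuclideanSpace ℝ (Fin n)} {T δ : ℝ} {r ubar : ℝ≥0}

/-- The velocity augmented by the running cost along a controlled curve, stopped at time `T`. -/
noncomputable def stoppedVelocity
    (f : EuclideanSpace ℝ (Fin n) → EuclideanSpace ℝ (Fin m) → EuclideanSpace ℝ (Fin n))
    (g : EuclideanSpace ℝ (Fin n) → EuclideanSpace ℝ (Fin m) → ℝ)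
    (x : ℝ → EuclideanSpace ℝ (Fin n)) (u : ℝ → EuclideanSpace ℝ (Fin m)) (T : ℝ) :
    ℝ → EuclideanSpace ℝ (Fin n) × ℝ :=
  (Ioc 0 T).indicator fun s => (f (x s) (u s), g (x s) (u s))

variable {x : ℝ → EuclideanSpace ℝ (Fin n)} {u : ℝ → EuclideanSpace ℝ (Fin m)} {B : ℝ≥0}

theorem norm_stoppedVelocity_le (hu : IsControl U u) (hxA : ∀ t ∈ Icc 0 T, x t ∈ A)
    (hB : ∀ x ∈ A, ∀ u ∈ U, ‖(f x u, g x u)‖ ≤ B) (s : ℝ) :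
    ‖stoppedVelocity f g x u T s‖ ≤ B := by
  by_cases hs : s ∈ Ioc 0 T
  · rw [stoppedVelocity, indicator_of_mem hs]
    exact hB _ (hxA s (Ioc_subset_Icc_self hs)) _ (hu.mem s hs.1.le)
  · rw [stoppedVelocity, indicator_of_notMem hs]
    simp

theorem intervalIntegrable_stoppedVelocity (hU : IsCompact U) (hA : IsClosed A)
    (hf : ContinuousOn (Function.uncurry f) (A ×ˢ U))
    (hg : ContinuousOn (Function.uncurry g) (A ×ˢ U)) (hu : IsControl U u)
    (hx : ContinuousOn x (Icc 0 T)) (hxA : ∀ t ∈ Icc 0 T, x t ∈ A)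
    (hB : ∀ x ∈ A, ∀ u ∈ U, ‖(f x u, g x u)‖ ≤ B) (a b : ℝ) :
    IntervalIntegrable (stoppedVelocity f g x u T) volume a b := by
  refine (intervalIntegrable_const (c := (B : ℝ))).mono_fun ?_ (ae_of_all _ fun s => ?_)
  · refine AEStronglyMeasurable.restrict ?_
    rw [stoppedVelocity, aestronglyMeasurable_indicator_iff measurableSet_Ioc]
    have hum := ((hu.locallyBounded T).1.mono_measure
      (Measure.restrict_mono Ioc_subset_Icc_self le_rfl)).aemeasurable
    have hxm := (hx.mono Ioc_subset_Icc_self).aemeasurable (μ := volume) measurableSet_Ioc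
    exact (hf.prodMk hg).aestronglyMeasurable_comp (w := fun s => (x s, u s))
      (hA.measurableSet.prod hU.measurableSet) (hxm.prodMk hum)
      ((ae_restrict_iff' measurableSet_Ioc).2 (ae_of_all _ fun s hs =>
        ⟨hxA s (Ioc_subset_Icc_self hs), hu.mem s hs.1.le⟩))
  · simpa using norm_stoppedVelocity_le hu hxA hB s

/-- Turns the integral cost into the terminal value of an extra state coordinate. -/
theorem integral_stoppedVelocity (hx : IsTrajectory G₁ f x₀ u (Icc 0 T) x)
    (hg0 : ∀ t ∈ Icc 0 T, 0 ≤ g (x t) (u t))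
    (hint : ∀ a b, IntervalIntegrable (stoppedVelocity f g x u T) volume a b) :
    (∀ t ∈ Icc 0 T, x t = x₀ + (∫ s in (0 : ℝ)..t, stoppedVelocity f g x u T s).1) ∧
      (0 ≤ T → (∫ s in (0 : ℝ)..T, stoppedVelocity f g x u T s).2
        = (runningCost g x u T).toReal) := by
  constructor
  · intro t ht
    have hfst := (ContinuousLinearMap.fst ℝ (EuclideanSpace ℝ (Fin n)) ℝ).intervalIntegral_comp_comm
      (hint 0 t)
    simp only [ContinuousLinearMap.coe_fst'] at hfst
    rw [hx.eq_integral t ht, ← hfst]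
    congr 1
    refine intervalIntegral.integral_congr_ae (ae_of_all _ fun s hs => ?_)
    rw [uIoc_of_le ht.1] at hs
    rw [stoppedVelocity, indicator_of_mem (show s ∈ Ioc 0 T from ⟨hs.1, hs.2.trans ht.2⟩)]
  · intro hT
    have hsnd := (ContinuousLinearMap.snd ℝ (EuclideanSpace ℝ (Fin n)) ℝ).intervalIntegral_comp_comm
      (hint 0 T)
    simp only [ContinuousLinearMap.coe_snd'] at hsnd
    have heq : EqOn (fun s => (stoppedVelocity f g x u T s).2) (fun s => g (x s) (u s))
        (Ioc 0 T) := fun s hs => by simp only [stoppedVelocity, indicator_of_mem hs]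
    have hm : IntegrableOn (fun s => g (x s) (u s)) (Ioc 0 T) :=
      (IntegrableOn.congr_fun
        ((intervalIntegrable_iff_integrableOn_Ioc_of_le hT).1 (hint 0 T)).snd heq
        measurableSet_Ioc)
    rw [← hsnd, intervalIntegral.integral_of_le hT, setIntegral_congr_fun measurableSet_Ioc heq,
      integral_eq_lintegral_of_nonneg_ae ((ae_restrict_iff' measurableSet_Ioc).2
        (ae_of_all _ fun s hs => hg0 s (Ioc_subset_Icc_self hs))) hm.aestronglyMeasurable,
      runningCost, setLIntegral_congr Ioc_ae_eq_Icc]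

/-- Bounded sequences of controlled trajectories reaching the target on bounded time intervals have
a limit which reaches the target at no more than the limit of the costs. -/
theorem exists_reaches_runningCost_le (hsys : SystemAssumption U G G₁ f)
    (hcost : RunningCostAssumption U G f g r ubar)
    (hconv : ∀ x ∈ closure G, Convex ℝ (augmentedVelocitySet U f g x))
    (hx₀ : x₀ ∈ G) {R S : ℝ} {V : ℝ≥0∞} (hV : V ≠ ∞)
    {u : ℕ → ℝ → EuclideanSpace ℝ (Fin m)} {T : ℕ → ℝ≥0} {x : ℕ → ℝ → EuclideanSpace ℝ (Fin n)}
    (hu : ∀ k, IsControl U (u k)) (hr : ∀ k, Reaches G₁ f δ x₀ (u k) (T k) (x k))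
    (hT : ∀ k, T k ≤ S) (hR : ∀ k, ∀ t ∈ Icc 0 (T k : ℝ), ‖x k t‖ ≤ R)
    (hJ : Tendsto (fun k => runningCost g (x k) (u k) (T k)) atTop (𝓝 V)) :
    ∃ u, IsControl U u ∧ ∃ T x, Reaches G₁ f δ x₀ u T x ∧ runningCost g x u T ≤ V := by
  have hR0 : 0 ≤ R := (norm_nonneg _).trans (hR 0 0 ⟨le_rfl, (T 0).2⟩)
  obtain ⟨A, hAdef⟩ : ∃ A, A = Metric.closedBall 0 R ∩ closure G := ⟨_, rfl⟩
  have hAc : IsCompact A := hAdef ▸ (isCompact_closedBall _ _).inter_right isClosed_closure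
  have hAG : A ⊆ closure G := hAdef ▸ inter_subset_right
  have hAG₁ : A ⊆ G₁ := hAG.trans hsys.closure_subset
  have hU := hsys.isCompact_U
  have hf : ContinuousOn (Function.uncurry f) (A ×ˢ U) :=
    hsys.continuousOn_f.mono (prod_mono hAG₁ le_rfl)
  have hg : ContinuousOn (Function.uncurry g) (A ×ˢ U) :=
    hcost.continuousOn_g.mono (prod_mono hAG le_rfl)
  have hg0 : ∀ x ∈ A, ∀ u ∈ U, 0 ≤ g x u := fun x hx => hcost.nonneg x (hAG hx)
  obtain ⟨B, hB⟩ : ∃ B : ℝ≥0, ∀ x ∈ A, ∀ u ∈ U, ‖(f x u, g x u)‖ ≤ B := by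
    obtain ⟨B, hB⟩ := ((hAc.prod hU).image_of_continuousOn
      (hf.prodMk hg)).isBounded.exists_norm_le
    exact ⟨B.toNNReal, fun x hx u hu =>
      (hB _ ⟨(x, u), ⟨hx, hu⟩, rfl⟩).trans (Real.le_coe_toNNReal B)⟩
  obtain ⟨L, hL0, hL⟩ : ∃ L : ℝ, 0 < L ∧ ∀ x ∈ A, ∀ x' ∈ A, ∀ u ∈ U,
      dist (f x u, g x u) (f x' u, g x' u) ≤ L * dist x x' := by
    -- `R` may be zero, while the Lipschitz hypotheses require a positive radius.
    obtain ⟨L₁, h1, hL₁⟩ := hsys.lipschitz (R + 1) (by positivity)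
    obtain ⟨L₂, h2, hL₂⟩ := hcost.lipschitz (R + 1) (by positivity)
    have hsub : A ⊆ Metric.closedBall 0 (R + 1) ∩ closure G :=
      hAdef ▸ inter_subset_inter_left _ (Metric.closedBall_subset_closedBall (by linarith))
    refine ⟨max L₁ L₂, by positivity, fun x hx x' hx' u hu => ?_⟩
    rw [Prod.dist_eq, dist_eq_norm x x']
    refine max_le ?_ ?_
    · rw [dist_eq_norm]
      exact (hL₁ x (hsub hx) x' (hsub hx') u hu).trans (by gcongr; exact le_max_left _ _)
    · rw [Real.dist_eq]
      exact (hL₂ x (hsub hx) x' (hsub hx') u hu).trans (by gcongr; exact le_max_right _ _)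
  have hxA : ∀ k, ∀ t ∈ Icc 0 (T k : ℝ), x k t ∈ A := fun k t ht =>
    hAdef ▸ ⟨by simpa using hR k t ht, (hr k).1.mem_closure hsys hx₀ (hu k) ht⟩
  set v : ℕ → ℝ → EuclideanSpace ℝ (Fin n) × ℝ := fun k =>
    stoppedVelocity f g (x k) (u k) (T k) with hvdef
  have hvB : ∀ k s, ‖v k s‖ ≤ B := fun k => norm_stoppedVelocity_le (hu k) (hxA k) hB
  have hvint : ∀ k a b, IntervalIntegrable (v k) volume a b := fun k =>
    intervalIntegrable_stoppedVelocity hU hAc.isClosed hf hg (hu k) (hr k).1.continuousOn (hxA k) hB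
  have hvI := fun k => integral_stoppedVelocity (hr k).1
    (fun t ht => hg0 _ (hxA k t ht) _ ((hu k).mem t ht.1)) (hvint k)
  set X : ℕ → ℝ → EuclideanSpace ℝ (Fin n) × ℝ := fun k t =>
    (x₀, 0) + ∫ s in (0 : ℝ)..t, v k s with hXdef
  have hX1 : ∀ k, ∀ t ∈ Icc 0 (T k : ℝ), (X k t).1 = x k t := fun k t ht =>
    ((hvI k).1 t ht).symm
  have hXend : ∀ k, (X k (T k)).1 = x k (T k) := fun k => hX1 k (T k) ⟨(T k).2, le_refl (T k : ℝ)⟩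
  have hX2 : ∀ k, (X k (T k)).2 = (runningCost g (x k) (u k) (T k)).toReal := fun k => by
    rw [← (hvI k).2 (T k).2]; exact zero_add _
  have hXlip : ∀ k, LipschitzWith B (X k) := fun k =>
    lipschitzWith_integral (hvint k) (hvB k) _
  obtain ⟨Y, hYlip, hY⟩ : ∃ Y, LipschitzWith B Y ∧
      ∀ t, Tendsto (fun k => X k t) (hyperfilter ℕ) (𝓝 (Y t)) :=
    exists_lipschitzWith_tendsto_integral hvint hvB (x₀, 0)
  have hY0 : Y 0 = (x₀, 0) := tendsto_nhds_unique (hY 0) (by simp [hXdef])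
  obtain ⟨τ, hτ⟩ := exists_tendsto_hyperfilter (w := fun k => (T k : ℝ)) (c := 0) (R := S)
    fun k => by simpa using hT k
  have hτ0 : 0 ≤ τ := ge_of_tendsto hτ (Eventually.of_forall fun k => (T k).2)
  -- The common Lipschitz constant upgrades pointwise convergence to convergence at the moving times
  -- `T k`.
  have hXT : Tendsto (fun k => X k (T k)) (hyperfilter ℕ) (𝓝 (Y τ)) := by
    have hd : Tendsto (fun k => X k (T k) - X k τ) (hyperfilter ℕ) (𝓝 0) := by
      refine squeeze_zero_norm (fun k => ?_)
        (show Tendsto (fun k => B * dist (T k : ℝ) τ) (hyperfilter ℕ) (𝓝 0) by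
          simpa using (hτ.dist (tendsto_const_nhds (x := τ))).const_mul (B : ℝ))
      rw [← dist_eq_norm]
      exact (hXlip k).dist_le_mul _ _
    simpa using hd.add (hY τ)
  have hlate : ∀ t < τ, ∀ᶠ k in (hyperfilter ℕ : Filter ℕ), t < T k := fun t ht =>
    hτ.eventually (lt_mem_nhds ht)
  have hYτA : (Y τ).1 ∈ A :=
    hAc.isClosed.mem_of_tendsto ((continuous_fst.tendsto _).comp hXT) (Eventually.of_forall
      fun k => by
        rw [Function.comp_apply, hXend]
        exact hxA k (T k) ⟨(T k).2, le_refl (T k : ℝ)⟩)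
  have hYA : ∀ t ∈ Icc 0 τ, (Y t).1 ∈ A := fun t ht => by
    rcases ht.2.eq_or_lt with rfl | hlt
    · exact hYτA
    refine hAc.isClosed.mem_of_tendsto ((continuous_fst.tendsto _).comp (hY t)) ?_
    filter_upwards [hlate t hlt] with k hk
    have hk : t ∈ Icc 0 (T k : ℝ) := ⟨ht.1, hk.le⟩
    rw [Function.comp_apply, hX1 k t hk]
    exact hxA k t hk
  have hYδ : (Y τ).1 ∈ Metric.closedBall 0 δ :=
    Metric.isClosed_closedBall.mem_of_tendsto ((continuous_fst.tendsto _).comp hXT)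
      (Eventually.of_forall fun k => by
        rw [Function.comp_apply, hXend]; exact (hr k).2)
  have hYV : (Y τ).2 = V.toReal := by
    refine tendsto_nhds_unique ((continuous_snd.tendsto _).comp hXT) ?_
    refine (((ENNReal.tendsto_toReal hV).comp hJ).mono_left ?_).congr fun k => (hX2 k).symm
    exact Nat.hyperfilter_le_atTop
  have hder : ∀ᵐ t, t ∈ Ioo 0 τ → deriv Y t ∈ augmentedVelocitySet U f g (Y t).1 := by
    filter_upwards [hYlip.ae_differentiableAt_real] with t htd ht
    have hYtA : (Y t).1 ∈ A := hYA t (Ioo_subset_Icc_self ht)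
    refine htd.hasDerivAt.mem_of_tendsto_integral (F := (hyperfilter ℕ : Filter ℕ)) (v := v)
      (X := X) (hconv _ (hAG hYtA))
      (isClosed_augmentedVelocitySet hU
        (hf.comp (f := fun y => ((Y t).1, y)) (by fun_prop) fun y hy => ⟨hYtA, hy⟩)
        (hg.comp (f := fun y => ((Y t).1, y)) (by fun_prop) fun y hy => ⟨hYtA, hy⟩))
      hvint (fun k a b => ?_) hY fun ε hε => ?_
    · rw [hXdef, add_sub_add_left_eq_sub,
        intervalIntegral.integral_interval_sub_left (hvint k _ _) (hvint k _ _)]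
    have hB1 : (0 : ℝ) < B + 1 := by positivity
    -- The first bound keeps `t + h₀` below `τ`, hence eventually below `T k`, before velocities are
    -- stopped. The second limits the motion to `ε / (2 * L)`; `B + 1` guards against `B = 0`.
    set h₀ : ℝ := min ((τ - t) / 2) (ε / (2 * L * (B + 1))) with hh₀
    have hh₀pos : 0 < h₀ := lt_min (by linarith [ht.2]) (by positivity)
    have hη : 0 < ε / (2 * L) := by positivity
    refine ⟨h₀, hh₀pos, ?_⟩
    filter_upwards [hlate (t + h₀) (by linarith [min_le_left ((τ - t) / 2) (ε / (2 * L * (B + 1))),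
      ht.2]), (hY t).eventually (Metric.ball_mem_nhds _ hη)] with k hk hkt s hs
    have hs0 : 0 < s := ht.1.trans hs.1
    have hsT : s ≤ T k := hs.2.trans hk.le
    have hsA := hxA k s ⟨hs0.le, hsT⟩
    have hdist : dist (x k s) (Y t).1 ≤ B * h₀ + ε / (2 * L) := by
      rw [← hX1 k s ⟨hs0.le, hsT⟩]
      calc dist (X k s).1 (Y t).1 ≤ dist (X k s) (Y t) := le_max_left _ _
        _ ≤ dist (X k s) (X k t) + dist (X k t) (Y t) := dist_triangle _ _ _
        _ ≤ B * h₀ + ε / (2 * L) := by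
          refine add_le_add (((hXlip k).dist_le_mul s t).trans ?_) (le_of_lt hkt)
          gcongr
          rw [Real.dist_eq, abs_of_pos (by linarith [hs.1])]
          linarith [hs.2]
    -- Compare with the velocity at the limit state under the same control value `u k s`; only the
    -- state changes, so the Lipschitz bound applies.
    refine Metric.mem_cthickening_of_dist_le (v k s)
      (f (Y t).1 (u k s), g (Y t).1 (u k s)) ε _ ⟨u k s, (hu k).mem s hs0.le, rfl, le_rfl⟩ ?_
    rw [hvdef]
    simp only [stoppedVelocity]
    rw [indicator_of_mem (show s ∈ Ioc 0 (T k : ℝ) from ⟨hs0, hsT⟩)]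
    refine (hL _ hsA _ hYtA _ ((hu k).mem s hs0.le)).trans ?_
    have hBh : B * h₀ ≤ ε / (2 * L) := by
      calc B * h₀ ≤ (B + 1) * (ε / (2 * L * (B + 1))) := by
            gcongr
            · linarith
            · exact min_le_right _ _
        _ = ε / (2 * L) := by field_simp
    calc L * dist (x k s) (Y t).1 ≤ L * (ε / (2 * L) + ε / (2 * L)) := by
          gcongr; exact hdist.trans (by linarith)
      _ = ε := by field_simp; norm_num
  obtain ⟨w, hw, y, hy, hyτ, hyV⟩ := exists_control_of_deriv_mem_augmentedVelocitySet hU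
    ⟨u 0 0, (hu 0).mem 0 le_rfl⟩ hAc.isClosed hAG₁ hf hg
    (fun x hx u hu => (le_max_left _ _).trans (hB x hx u hu)) hg0 hYlip hY0 hτ0 hYA hder
  refine ⟨w, hw, ⟨τ, hτ0⟩, y, ⟨hy, ?_⟩, hyV.trans ?_⟩
  · exact (show y τ = _ from hyτ) ▸ hYδ
  · rw [hYV, ENNReal.ofReal_toReal hV]

end Existence

/-! ### Existence of minimizers and equivalence of the two problems. -/

section Optimal

variable {n m : ℕ} {U : Set (EuclideanSpace ℝ (Fin m))} {G G₁ : Set (EuclideanSpace ℝ (Fin n))}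
  {f : EuclideanSpace ℝ (Fin n) → EuclideanSpace ℝ (Fin m) → EuclideanSpace ℝ (Fin n)}
  {g : EuclideanSpace ℝ (Fin n) → EuclideanSpace ℝ (Fin m) → ℝ}
  {x₀ : EuclideanSpace ℝ (Fin n)} {δ : ℝ} {r ubar : ℝ≥0}

theorem freeTimeValue_le {u : ℝ → EuclideanSpace ℝ (Fin m)} {T : ℝ≥0}
    {x : ℝ → EuclideanSpace ℝ (Fin n)} (hu : IsControl U u) (h : Reaches G₁ f δ x₀ u T x) :
    freeTimeValue U G₁ f g δ x₀ ≤ runningCost g x u T :=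
  sInf_le ⟨u, hu, T, x, h, rfl⟩

/-- A control steering to the origin enters the ball in finite time, and the cost of a bounded time
interval is finite. -/
theorem freeTimeValue_lt_top (hsys : SystemAssumption U G G₁ f)
    (hcost : RunningCostAssumption U G f g r ubar) (hδ : 0 < δ)
    (hx₀ : x₀ ∈ nullControllableRegion U G G₁ f) : freeTimeValue U G₁ f g δ x₀ < ∞ := by
  obtain ⟨hxG, u, hu, x, hx, hlim⟩ := hx₀
  obtain ⟨T, hT0, hT⟩ := ((eventually_ge_atTop 0).and (hlim.eventually (gt_mem_nhds hδ))).exists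
  lift T to ℝ≥0 using hT0
  have hxT : IsTrajectory G₁ f x₀ u (Icc 0 (T : ℝ)) x := hx.mono Icc_subset_Ici_self
  exact (freeTimeValue_le hu ⟨hxT, by simpa using hT.le⟩).trans_lt
    (runningCost_lt_top hsys hcost hxG hu hxT)

/-- Stopping at the exit time is admissible with free terminal time; conversely, cutting at first
entry cannot increase the cost. -/
theorem freeTimeValue_eq_exitTimeValue (hsys : SystemAssumption U G G₁ f) (hx₀ : x₀ ∈ G) :
    freeTimeValue U G₁ f g δ x₀ = exitTimeValue U G₁ f g δ x₀ := by
  refine le_antisymm (le_sInf ?_) (le_sInf ?_)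
  · rintro _ ⟨u, hu, hlt, x, hx, rfl⟩
    obtain ⟨_, ⟨T, y, hy, rfl⟩, -⟩ := sInf_lt_iff.1 hlt
    obtain ⟨τ, -, hyτ, hτ, -⟩ := hy.exists_first hsys hx₀ hu
    rw [hτ, ENNReal.coe_toReal] at hx ⊢
    rw [runningCost_congr (hx.eqOn hsys hx₀ hu hyτ.1)]
    exact freeTimeValue_le hu hyτ
  · rintro _ ⟨u, hu, T, x, hx, rfl⟩
    obtain ⟨τ, hτT, hxτ, hτ, -⟩ := hx.exists_first hsys hx₀ hu
    refine le_trans (sInf_le ⟨u, hu, hτ ▸ ENNReal.coe_lt_top, x, ?_, rfl⟩) ?_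
    · rw [hτ, ENNReal.coe_toReal]; exact hxτ.1
    · rw [hτ, ENNReal.coe_toReal]
      exact runningCost_mono (by exact_mod_cast hτT)

theorem IsFreeTimeOptimal.isExitTimeOptimal {u : ℝ → EuclideanSpace ℝ (Fin m)}
    (hsys : SystemAssumption U G G₁ f) (hx₀ : x₀ ∈ G)
    (hu : IsFreeTimeOptimal U G₁ f g δ x₀ u) : IsExitTimeOptimal U G₁ f g δ x₀ u := by
  obtain ⟨hu, T, x, hx, hval⟩ := hu
  obtain ⟨τ, hτT, hxτ, hτ, -⟩ := hx.exists_first hsys hx₀ hu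
  refine ⟨hu, hτ ▸ ENNReal.coe_lt_top, x, ?_, ?_⟩
  · rw [hτ, ENNReal.coe_toReal]; exact hxτ.1
  · rw [hτ, ENNReal.coe_toReal, ← freeTimeValue_eq_exitTimeValue hsys hx₀]
    exact le_antisymm ((runningCost_mono (by exact_mod_cast hτT)).trans_eq hval)
      (freeTimeValue_le hu hxτ)

theorem exists_isFreeTimeOptimal (hsys : SystemAssumption U G G₁ f)
    (hcost : RunningCostAssumption U G f g r ubar)
    (hconv : ∀ x ∈ closure G, Convex ℝ (augmentedVelocitySet U f g x)) (hδ : 0 < δ)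
    (hx₀ : x₀ ∈ G) (hfin : freeTimeValue U G₁ f g δ x₀ < ∞) :
    ∃ u, IsFreeTimeOptimal U G₁ f g δ x₀ u := by
  obtain ⟨C, hC, hgrow⟩ := hcost.growth
  obtain ⟨c, hc, hpos⟩ := hcost.pos_away δ hδ
  set V := freeTimeValue U G₁ f g δ x₀ with hV
  have hmin : ∀ k : ℕ, ∃ u, IsControl U u ∧ ∃ T x, Reaches G₁ f δ x₀ u T x ∧
      (∀ t ∈ Ico (0 : ℝ) T, δ < ‖x t‖) ∧ runningCost g x u T ≤ V + 1 / (k + 1 : ℝ≥0∞) := by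
    intro k
    obtain ⟨_, ⟨u, hu, T, x, hx, rfl⟩, hlt⟩ := sInf_lt_iff.1
      (ENNReal.lt_add_right (a := V) hfin.ne (b := 1 / (k + 1 : ℝ≥0∞)) (by simp))
    -- Cutting at first entry keeps the state outside the ball before `τ`, where the cost accrues at
    -- rate at least `c`; this bounds the times.
    obtain ⟨τ, hτT, hxτ, -, hout⟩ := hx.exists_first hsys hx₀ hu
    exact ⟨u, hu, τ, x, hxτ, hout, (runningCost_mono (by exact_mod_cast hτT)).trans hlt.le⟩
  choose u hu T x hr hout hle using hmin
  have hle1 : ∀ k, runningCost g (x k) (u k) (T k) ≤ V + 1 := fun k =>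
    (hle k).trans (by gcongr; simp)
  have hV1 : V + 1 ≠ ∞ := by simpa using hfin.ne
  have hcl : ∀ k, ∀ t ∈ Icc 0 (T k : ℝ), x k t ∈ closure G := fun k t ht =>
    (hr k).1.mem_closure hsys hx₀ (hu k) ht
  have hT : ∀ k, (T k : ℝ) ≤ c⁻¹ * (V + 1).toReal := fun k => by
    have h := (ofReal_mul_le_runningCost (T := T k) (c := c) (g := g) (x := x k) (u := u k)
      (T k).2 fun t ht => hpos _ (hcl k t (Ico_subset_Icc_self ht)) _ ((hu k).mem t ht.1)
        (hout k t ht).le).trans (hle1 k)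
    rw [ENNReal.ofReal_le_iff_le_toReal hV1] at h
    rwa [← div_eq_inv_mul, le_div_iff₀' hc]
  -- The radius must reach `2 * r` for the growth condition to hold beyond it, and `‖x₀‖` so that
  -- trajectories start inside.
  have hR : ∀ k, ∀ t ∈ Icc 0 (T k : ℝ),
      ‖x k t‖ ≤ max ‖x₀‖ (2 * r) + C⁻¹ * (V + 1).toReal := fun k t ht => by
    refine ((hr k).1.norm_le (g := g) hC (le_max_left _ (2 * (r : ℝ))) (fun s hs hRs => ?_)
      ((hle1 k).trans_lt hV1.lt_top).ne ht).trans ?_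
    · exact hgrow _ (hcl k s hs) _ ((hu k).mem s hs.1) (Or.inl ((le_max_right _ _).trans hRs))
    · gcongr
      exact hle1 k
  have hJ : Tendsto (fun k => runningCost g (x k) (u k) (T k)) atTop (𝓝 V) := by
    refine tendsto_of_tendsto_of_tendsto_of_le_of_le tendsto_const_nhds ?_
      (fun k => freeTimeValue_le (hu k) (hr k)) hle
    have h0 : Tendsto (fun k : ℕ => 1 / (k + 1 : ℝ≥0∞)) atTop (𝓝 0) := by
      simpa using (tendsto_add_atTop_iff_nat 1).2 ENNReal.tendsto_inv_nat_nhds_zero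
    simpa using h0.const_add V
  obtain ⟨w, hw, τ, y, hy, hyV⟩ :=
    exists_reaches_runningCost_le hsys hcost hconv hx₀ hfin.ne hu hr hT hR hJ
  exact ⟨w, hw, τ, y, hy, le_antisymm hyV (freeTimeValue_le hw hy)⟩

end Optimal

theorem theorem3p11 {n m : ℕ}
    (U : Set (EuclideanSpace ℝ (Fin m))) (G G₁ : Set (EuclideanSpace ℝ (Fin n)))
    (f : EuclideanSpace ℝ (Fin n) → EuclideanSpace ℝ (Fin m) → EuclideanSpace ℝ (Fin n))
    (g : EuclideanSpace ℝ (Fin n) → EuclideanSpace ℝ (Fin m) → ℝ)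
    (r ubar : ℝ≥0) (β : ℝ≥0 → ℝ≥0 → ℝ≥0) (α₁ α₂ : ℝ≥0 → ℝ≥0)
    (hsys : SystemAssumption U G G₁ f)
    (hα₁ : IsClassKInfty α₁) (hα₂ : IsClassKInfty α₂)
    (hβ : ∀ ρ t : ℝ≥0, β ρ t ≤ α₂ (α₁ ρ * Real.toNNReal (Real.exp (-(t : ℝ)))))
    (hctrl : (LocallyNullControllable U G G₁ f r ubar β ∧ CostBoundState U g r ubar α₂) ∨
      (SmallControlProperty U G G₁ f r β ∧ ubar = β r 0 ∧
        CostBoundStateControl U g r ubar α₂))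
    (hcost : RunningCostAssumption U G f g r ubar)
    (hconv : ∀ x ∈ closure G,
      Convex ℝ {q : EuclideanSpace ℝ (Fin n) × ℝ | ∃ u ∈ U, q.1 = f x u ∧ g x u ≤ q.2})
    (δ : ℝ) (hδ : 0 < δ) (hδr : δ ≤ r)
    (x₀ : EuclideanSpace ℝ (Fin n))
    (hx₀ : x₀ ∈ nullControllableRegion U G G₁ f \ Metric.closedBall 0 δ) :
    freeTimeValue U G₁ f g δ x₀ = exitTimeValue U G₁ f g δ x₀ ∧
      freeTimeValue U G₁ f g δ x₀ < ∞ ∧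
      ∃ u, IsFreeTimeOptimal U G₁ f g δ x₀ u ∧ IsExitTimeOptimal U G₁ f g δ x₀ u := by
  have hfin := freeTimeValue_lt_top (δ := δ) hsys hcost hδ hx₀.1
  obtain ⟨u, hu⟩ := exists_isFreeTimeOptimal hsys hcost hconv hδ hx₀.1.1 hfin
  exact ⟨freeTimeValue_eq_exitTimeValue hsys hx₀.1.1, hfin, u, hu,
    hu.isExitTimeOptimal hsys hx₀.1.1⟩
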